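/- **Setting.** For $\lambda>0$, a homogeneous Poisson process on $\mathbb R$ with rate $\lambda$ is a map $\Pi$ from a probability space to the countable subsets of $\mathbb R$ such that the counts $N(A)=\#(\Pi\cap A)$ ($A$ Borel) are measurable, are independent for finitely many pairwise disjoint sets, and are Poisson distributed with mean $\lambda|A|$ (with $N(A)=\infty$ a.s. if $|A|=\infty$). A non-homogeneous Poisson process with locally integrable rate function $\lambda:\mathbb R\to[0,\infty)$ is a map $\Pi$ into the countable subsets of $\mathbb R$ such that $M(\Pi)$ is a homogeneous Poisson process on $\mathbb R$ with rate $1$, where $M(t)=\int_0^t\lambda(s)\,ds$. Let $n\ge 1$ and let $\Pi_0,\dots,\Pi_n$ be independent non-homogeneous Poisson processes with rates $\lambda_0,\dots,\lambda_n$ on a probability space $(\Omega,\mathcal F,\mathbb P)$ from which null events have been removed such that, for every $\omega\in\Omega$, the sets $\Pi_k(\omega)$ are pairwise disjoint and finite on bounded intervals, and no point $s\in\Pi_k(\omega)$ satisfies $M_k(s)=M_k(t)$ for some $t\ne s$, where $M_k(t)=\int_0^t\lambda_k(s)\,ds$. Let $X=\{0,1\}^n$ with the discrete metric. For $x=(s_1,\dots,s_n)\in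 X$ and $k\in\{0,\dots,n\}$ let $f(x,k)$ arise from $x$ by setting $s_1:=1$ if $k=0$; by setting $s_n:=0$ if $k=n$; by setting $s_k:=0$, $s_{k+1}:=1$ if $0<k<n$, $s_k=1$ and $s_{k+1}=0$; and let $f(x,k)=x$ otherwise. For $t\ge t_0$ let $\phi(t,t_0,x,\omega)$ be the state obtained from $x$ by applying $f(\cdot,k)$ successively, in increasing order of time, for all jump times of $\Pi_0(\omega),\dots,\Pi_n(\omega)$ in $[t_0,t)$, where $k$ is the index of the process to which the jump time belongs (TASEP with time-varying rates). Put $$A(t,\omega)=\bigcap_{t_0\le t}\phi(t,t_0,X,\omega),\qquad \Gamma(t,t_0)=\{\omega:\ \phi(t,t_0,x_1,\omega)=\phi(t,t_0,x_2,\omega)\ \text{for all } x_1,x_2\in X\}.$$ A family $(A(t))_{t\in\mathbb R}$ of measurable subsets of $X\times\Omega$ with compact sections $A(t,\omega)$ that satisfies, almost surely, $\phi(t,t_0,A(t_0,\omega),\omega)=A(t,\omega)$ for all $t\ge t_0$ is a *global random pullback attractor* if for each $t$ almost surely $\lim_{t_0\to-\infty}\operatorname{dist}(\phi(t,t_0,X,\omega),A(t,\omega))=0$,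 and a *global random forward attractor* if for each $t_0$ almost surely $\lim_{t\to\infty}\operatorname{dist}(\phi(t,t_0,X,\omega),A(t,\omega))=0$; here $\operatorname{dist}(B,C)=\sup_{b\in B}\inf_{c\in C}d(b,c)$. For $R>r>0$ and $m\in\mathbb N$ the rates are *jointly $(r,R,m)$-bounded* on $[\tau_1,\tau_2)$ if there are $\tau_1=q_0<q_1<\dots<q_m=\tau_2$ with $r\le\int_{q_i}^{q_{i+1}}\lambda_k(t)\,dt\le R$ for all $i=0,\dots,m-1$ and $k=0,\dots,n$. **Theorem.** The map $\phi$ is a nonautonomous random dynamical system: it is jointly measurable in $((t,t_0),x,\omega)$ on $t\ge t_0$, continuous in $x$, $\phi(t,t,\cdot,\omega)=\mathrm{id}$, and $\phi(t,t_0,x,\omega)=\phi(t,s,\phi(s,t_0,x,\omega),\omega)$ for all $t\ge s\ge t_0$. Moreover: (a) Suppose there are $R>r>0$ such that for each $t\in\mathbb R$ there is $t_0<t$ for which the rates are jointly $(r,R,n(n+1)/2)$-bounded on $[t_0,t)$. Then the sets $A(t,\omega)$ define a global random pullback attractor, and for almost all $\omega$ the set $A(t,\omega)$ is a singleton for all $t\in\mathbb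 R$. (b) Suppose there are $R>r>0$ and $\Delta t>0$ such that for every $\tau\in\mathbb R$ the rates are jointly $(r,R,n(n+1)/2)$-bounded on $[\tau,\tau+\Delta t)$. Then the sets $A(t,\omega)$ also provide a global random forward attractor, and the synchronization probability converges to $1$ at an exponential rate: there are $C,\gamma>0$ with $1-\mathbb P(\Gamma(t,t_0))\le C e^{-\gamma(t-t_0)}$ for all $t\ge t_0$. -/

import Mathlib

open MeasureTheory ProbabilityTheory Filter Topology
open scoped ENNReal

noncomputable section

/-! ## Nonautonomous random dynamical systems and their attractors -/

section NRDS

variable {X Ω : Type*} [MetricSpace X] [MeasurableSpace X] [MeasurableSpace Ω]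

/-- A nonautonomous random dynamical system `φ t t₀ x ω` (time `t`, initial time `t₀ ≤ t`, initial
state `x`) on a Polish metric space `X` with its Borel sigma-algebra. The values of `φ` at pairs
`(t, t₀)` with `t < t₀` are irrelevant. -/
structure IsNRDS [PolishSpace X] [BorelSpace X] (φ : ℝ → ℝ → X → Ω → X) : Prop where
  measurable : Measurable fun p : {q : ℝ × ℝ // q.2 ≤ q.1} × X × Ω =>
    φ p.1.1.1 p.1.1.2 p.2.1 p.2.2
  id_diag : ∀ t x ω, φ t t x ω = x
  cocycle : ∀ t s t₀, t₀ ≤ s → s ≤ t → ∀ x ω, φ t t₀ x ω = φ t s (φ s t₀ x ω) ω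
  continuous : ∀ t t₀, t₀ ≤ t → ∀ ω, Continuous fun x => φ t t₀ x ω

/-- The Hausdorff semi-distance `sup_{a ∈ A} inf_{b ∈ B} d(a, b)`, with values in `[0, ∞]`, so that
the infimum over the empty set is `∞`. -/
def semiDist (A B : Set X) : ℝ≥0∞ := ⨆ a ∈ A, ⨅ b ∈ B, edist a b

/-- The image `φ(t, t₀, B, ω)` of a set `B` of states. -/
def imageSet (φ : ℝ → ℝ → X → Ω → X) (t t₀ : ℝ) (B : Set X) (ω : Ω) : Set X :=
  (fun x => φ t t₀ x ω) '' B

/-- A compact nonautonomous random set, given through its sections `C t ω`. -/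
structure IsCompactRandomSet (C : ℝ → Ω → Set X) : Prop where
  measurableSet : ∀ t, MeasurableSet {p : X × Ω | p.1 ∈ C t p.2}
  isCompact : ∀ t ω, IsCompact (C t ω)

/-- A compact nonautonomous random set that is almost surely strictly `φ`-invariant. -/
structure IsInvariantRandomSet (P : Measure Ω) (φ : ℝ → ℝ → X → Ω → X) (A : ℝ → Ω → Set X) :
    Prop extends IsCompactRandomSet A where
  invariant : ∀ᵐ ω ∂P, ∀ t t₀, t₀ ≤ t → imageSet φ t t₀ (A t₀ ω) ω = A t ω

/-- Global random pullback attractors of `φ`. -/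
structure IsPullbackAttractor (P : Measure Ω) (φ : ℝ → ℝ → X → Ω → X) (A : ℝ → Ω → Set X) :
    Prop extends IsInvariantRandomSet P φ A where
  attracts : ∀ t, ∀ᵐ ω ∂P,
    Tendsto (fun t₀ => semiDist (imageSet φ t t₀ Set.univ ω) (A t ω)) atBot (𝓝 0)

/-- Global random forward attractors of `φ`. -/
structure IsForwardAttractor (P : Measure Ω) (φ : ℝ → ℝ → X → Ω → X) (A : ℝ → Ω → Set X) :
    Prop extends IsInvariantRandomSet P φ A where
  attracts : ∀ t₀, ∀ᵐ ω ∂P,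
    Tendsto (fun t => semiDist (imageSet φ t t₀ Set.univ ω) (A t ω)) atTop (𝓝 0)

/-- The sets `A(t, ω) = ⋂_{t₀ ≤ t} φ(t, t₀, X, ω)`. -/
def attractorSet (φ : ℝ → ℝ → X → Ω → X) (t : ℝ) (ω : Ω) : Set X :=
  ⋂ t₀ ∈ Set.Iic t, imageSet φ t t₀ Set.univ ω

/-- The event `Γ(t, t₀)` that all solutions started at time `t₀` agree at time `t`. -/
def syncEvent (φ : ℝ → ℝ → X → Ω → X) (t t₀ : ℝ) : Set Ω :=
  {ω | ∀ x₁ x₂, φ t t₀ x₁ ω = φ t t₀ x₂ ω}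

end NRDS

/-! ## Poisson processes on the real line -/

section Poisson

variable {Ω : Type*} [MeasurableSpace Ω]

/-- The number `N(A)` of points in `A` of a random set of points. -/
def pointCount (S : Ω → Set ℝ) (A : Set ℝ) (ω : Ω) : ℕ∞ := (S ω ∩ A).encard

/-- Homogeneous Poisson processes on `ℝ` with rate `c`. A Poisson variable with infinite mean
is almost surely infinite. -/
structure IsHomogeneousPoisson (P : Measure Ω) (c : ℝ) (S : Ω → Set ℝ) : Prop where
  countable : ∀ ω, (S ω).Countable
  measurable : ∀ A, MeasurableSet A → Measurable (pointCount S A)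
  indep : ∀ (p : ℕ) (A : Fin p → Set ℝ), (∀ i, MeasurableSet (A i)) →
    Pairwise (Function.onFun Disjoint A) → iIndepFun (fun i => pointCount S (A i)) P
  poisson : ∀ A, MeasurableSet A → volume A ≠ ∞ → ∀ k : ℕ,
    P {ω | pointCount S A ω = k} =
      ENNReal.ofReal ((c * volume.real A) ^ k / k.factorial * Real.exp (-(c * volume.real A)))
  poisson_top : ∀ A, MeasurableSet A → volume A = ∞ → ∀ᵐ ω ∂P, pointCount S A ω = ⊤

/-- The cumulative rate `M(t) = ∫_0^t lam(s) ds`. -/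
def cumRate (lam : ℝ → ℝ) (t : ℝ) : ℝ := ∫ s in (0 : ℝ)..t, lam s

/-- Non-homogeneous Poisson processes on `ℝ` with locally integrable rate `lam ≥ 0`: the time change
by `M` turns the process into a homogeneous Poisson process of rate `1`. -/
structure IsPoisson (P : Measure Ω) (lam : ℝ → ℝ) (S : Ω → Set ℝ) : Prop where
  countable : ∀ ω, (S ω).Countable
  nonneg : ∀ t, 0 ≤ lam t
  locallyIntegrable : LocallyIntegrable lam volume
  timeChange : IsHomogeneousPoisson P 1 fun ω => cumRate lam '' S ω

/-- The sigma-algebra generated by a random set of points, i.e. by all its counts. -/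
@[reducible]
def pointSigma (S : Ω → Set ℝ) : MeasurableSpace Ω :=
  ⨆ A : {A : Set ℝ // MeasurableSet A}, MeasurableSpace.comap (pointCount S A.1) inferInstance

end Poisson

/-! ## The TASEP with time-varying rates -/

namespace TASEP

/-- Configurations of the chain with sites `1, …, n`; the coordinate `j : Fin n` belongs to
site `j + 1`, and `true` means occupied. -/
def Config (n : ℕ) : Type := Fin n → Bool

instance (n : ℕ) : DecidableEq (Config n) := inferInstanceAs (DecidableEq (Fin n → Bool))

instance (n : ℕ) : Fintype (Config n) := inferInstanceAs (Fintype (Fin n → Bool))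

/-- The discrete metric. -/
instance (n : ℕ) : MetricSpace (Config n) where
  dist x y := if x = y then 0 else 1
  dist_self x := by simp
  dist_comm x y := by simp only [eq_comm]
  dist_triangle x y z := by
    by_cases hxy : x = y
    · subst hxy; simp
    · have h : (0 : ℝ) ≤ if y = z then 0 else 1 := by split_ifs <;> norm_num
      have h' : (if x = z then (0 : ℝ) else 1) ≤ 1 := by split_ifs <;> norm_num
      simp only [hxy, if_false]
      linarith
  eq_of_dist_eq_zero {x y} h := by
    by_contra hxy
    simp [hxy] at h

instance (n : ℕ) : MeasurableSpace (Config n) := ⊤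

instance (n : ℕ) : BorelSpace (Config n) where
  measurable_eq := by
    rw [borel_eq_top_of_discrete]
    rfl

/-- The effect `f(x, k)` of a jump attempt of clock `k ∈ {0, …, n}`: entry for `k = 0`, exit for
`k = n`, and a hop from site `k` to site `k + 1` otherwise. -/
def hop {n : ℕ} (x : Config n) (k : Fin (n + 1)) : Config n :=
  if (k : ℕ) = 0 then
    fun j => if (j : ℕ) = 0 then true else x j
  else if hk : (k : ℕ) = n then
    fun j => if (j : ℕ) = n - 1 then false else x j
  else if x ⟨k - 1, by omega⟩ = true ∧ x ⟨k, by omega⟩ = false then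
    fun j => if (j : ℕ) = k - 1 then false else if (j : ℕ) = k then true else x j
  else x

variable {n : ℕ} {Ω : Type*}

/-- The jump attempts in `[t₀, t)`: pairs of a jump time and the index of the clock. -/
def jumpSet (jumps : Fin (n + 1) → Ω → Set ℝ) (t t₀ : ℝ) (ω : Ω) : Set (ℝ ×ₗ Fin (n + 1)) :=
  {e | (ofLex e).1 ∈ Set.Ico t₀ t ∧ (ofLex e).1 ∈ jumps (ofLex e).2 ω}

open Classical in
/-- The jump attempts in `[t₀, t)` in the order of their times (the jump times of different clocks
being distinct, and finite in number on bounded intervals). -/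
def jumpList (jumps : Fin (n + 1) → Ω → Set ℝ) (t t₀ : ℝ) (ω : Ω) : List (ℝ ×ₗ Fin (n + 1)) :=
  if h : (jumpSet jumps t t₀ ω).Finite then h.toFinset.sort (· ≤ ·) else []

/-- The TASEP flow `φ(t, t₀, x, ω)`: starting from `x`, carry out successively all jump attempts in
`[t₀, t)`. -/
def flow (jumps : Fin (n + 1) → Ω → Set ℝ) (t t₀ : ℝ) (x : Config n) (ω : Ω) : Config n :=
  (jumpList jumps t t₀ ω).foldl (fun y e => hop y (ofLex e).2) x

/-- The clocks that drive the TASEP: independent non-homogeneous Poisson processes with rates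
`lam 0, …, lam n`, where null events are removed from the probability space such that, for every
outcome, no point lies where the cumulative rate is not injective, the jump times do not
accumulate, and the jump times of different clocks are distinct. -/
structure IsClockFamily [MeasurableSpace Ω] (P : Measure Ω) (lam : Fin (n + 1) → ℝ → ℝ)
    (jumps : Fin (n + 1) → Ω → Set ℝ) : Prop where
  poisson : ∀ k, IsPoisson P (lam k) (jumps k)
  indep : iIndep (fun k => pointSigma (jumps k)) P
  not_flat : ∀ k ω, ∀ s ∈ jumps k ω, ∀ t, cumRate (lam k) t = cumRate (lam k) s → t = s
  finite : ∀ k ω a b, (jumps k ω ∩ Set.Icc a b).Finite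
  disjoint : ∀ ω, Pairwise fun k l => Disjoint (jumps k ω) (jumps l ω)

/-- The rates `lam 0, …, lam n` are jointly `(r, R, m)`-bounded on `[τ₁, τ₂)`. -/
def JointlyBounded (lam : Fin (n + 1) → ℝ → ℝ) (r R : ℝ) (m : ℕ) (τ₁ τ₂ : ℝ) : Prop :=
  ∃ q : Fin (m + 1) → ℝ, StrictMono q ∧ q 0 = τ₁ ∧ q (Fin.last m) = τ₂ ∧
    ∀ (i : Fin m) (k : Fin (n + 1)),
      r ≤ (∫ t in (q i.castSucc)..(q i.succ), lam k t) ∧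
        (∫ t in (q i.castSucc)..(q i.succ), lam k t) ≤ R

end TASEP

end

namespace TASEP

/-! ### Jump attempts -/

section Hop

variable {n : ℕ}

/-! Synchronization rests on a reset word: a fixed sequence of `n * (n + 1) / 2` clocks (`fillWord`)
that takes every configuration to the full one. Cut a time interval into that many windows. If in
window `i` the `i`-th clock of the word rings and no other does, all solutions agree at the end
(`ringEvent_subset_syncEvent`). Repeated rings do no harm, since `hop_hop` makes each jump attempt
idempotent.

Joint `(r, R, m)`-boundedness makes a prescribed clock ring in a window with probability at least `1
- exp (-r)` and stay silent with probability at least `exp (-R)`. Independence over clocks and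
windows bounds the probability of the whole pattern below by a positive constant. Patterns on
disjoint intervals are independent, so the probability that `N` intervals all fail decays
geometrically (`exists_measure_iInter_compl_syncEvent_le`).

Invariance and pullback attraction are finiteness facts: the images of the state space decrease as
the starting time recedes, hence become constant. Synchronization turns the attractor into a
singleton and, once it has occurred, makes the forward distance zero. Joint measurability comes from
discretizing time. -/

theorem hop_apply_of_eq_zero (x : Config n) {k : Fin (n + 1)} (h0 : (k : ℕ) = 0) (j : Fin n) :
    hop x k j = if (j : ℕ) = 0 then true else x j :=
  congrFun (if_pos h0) j

theorem hop_apply_of_eq_last (x : Config n) {k : Fin (n + 1)} (h0 : (k : ℕ) ≠ 0)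
    (hk : (k : ℕ) = n) (j : Fin n) : hop x k j = if (j : ℕ) = n - 1 then false else x j :=
  congrFun ((if_neg h0).trans (dif_pos hk)) j

theorem hop_apply_of_free (x : Config n) {k : Fin (n + 1)} (h0 : (k : ℕ) ≠ 0) (hk : (k : ℕ) ≠ n)
    (hx : x ⟨k - 1, by omega⟩ = true ∧ x ⟨k, by omega⟩ = false) (j : Fin n) :
    hop x k j = if (j : ℕ) = k - 1 then false else if (j : ℕ) = k then true else x j := by
  have h : hop x k = (fun j : Fin n => if (j : ℕ) = k - 1 then false else
      if (j : ℕ) = k then true else x j) :=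
    (if_neg h0).trans ((dif_neg hk).trans (if_pos hx))
  exact congrFun h j

theorem hop_of_blocked (x : Config n) {k : Fin (n + 1)} (h0 : (k : ℕ) ≠ 0) (hk : (k : ℕ) ≠ n)
    (hx : ¬(x ⟨k - 1, by omega⟩ = true ∧ x ⟨k, by omega⟩ = false)) : hop x k = x :=
  (if_neg h0).trans ((dif_neg hk).trans (if_neg hx))

/-- Because of this, a window only has to contain some ring of its clock; the number of rings is
irrelevant. -/
theorem hop_hop (x : Config n) (k : Fin (n + 1)) : hop (hop x k) k = hop x k := by
  by_cases h0 : (k : ℕ) = 0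
  · funext j
    rw [hop_apply_of_eq_zero _ h0, hop_apply_of_eq_zero _ h0]
    split_ifs <;> rfl
  by_cases hk : (k : ℕ) = n
  · funext j
    rw [hop_apply_of_eq_last _ h0 hk, hop_apply_of_eq_last _ h0 hk]
    split_ifs <;> rfl
  by_cases hx : x ⟨k - 1, by omega⟩ = true ∧ x ⟨k, by omega⟩ = false
  · refine hop_of_blocked _ h0 hk fun h => ?_
    rw [hop_apply_of_free x h0 hk hx, if_pos rfl] at h
    exact Bool.false_ne_true h.1
  · rw [hop_of_blocked x h0 hk hx, hop_of_blocked x h0 hk hx]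

theorem foldl_hop_of_forall_eq {α : Type*} (g : α → Fin (n + 1)) (k : Fin (n + 1)) (l : List α)
    (hl : l ≠ []) (h : ∀ e ∈ l, g e = k) (x : Config n) :
    l.foldl (fun y e => hop y (g e)) x = hop x k := by
  induction l generalizing x with
  | nil => exact absurd rfl hl
  | cons e l ih =>
    rw [List.foldl_cons, h e (by simp)]
    rcases eq_or_ne l [] with rfl | hl'
    · rfl
    · rw [ih hl' (fun e he => h e (by simp [he])), hop_hop]

/-- A word of clocks of length `d (d + 1) / 2` that fills the sites with index below `d`, provided
that all later sites are occupied. -/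
def fillWord (n : ℕ) : ℕ → List (Fin (n + 1))
  | 0 => []
  | d + 1 => (List.range (d + 1)).map (Fin.ofNat (n + 1)) ++ fillWord n d

theorem length_fillWord (n d : ℕ) : (fillWord n d).length = d * (d + 1) / 2 := by
  have h : 2 * (fillWord n d).length = d * (d + 1) := by
    induction d with
    | zero => rfl
    | succ d ih =>
      rw [fillWord, List.length_append, List.length_map, List.length_range, mul_add, ih]
      ring
  omega

/-- Invariant of the sweep `0, 1, 2, …`: the site reached last is occupied. Clock `e` either moves
the particle at index `e - 1` to index `e` or is blocked because index `e` is already occupied. It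
vacates only index `e - 1`, which is below `d`, so the filled end of the chain is untouched. -/
theorem foldl_hop_range (x : Config n) (d e : ℕ) (hd : d ≤ n) (he : e ≤ d)
    (hx : ∀ j : Fin n, d ≤ (j : ℕ) → x j = true) (j : Fin n)
    (hj : d ≤ (j : ℕ) ∨ (j : ℕ) + 1 = e) :
    ((List.range e).map (Fin.ofNat (n + 1))).foldl hop x j = true := by
  induction e generalizing j with
  | zero => exact hx j (by omega)
  | succ e ih =>
    rw [List.range_succ, List.map_append, List.foldl_append]
    set y := ((List.range e).map (Fin.ofNat (n + 1))).foldl hop x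
    have hval : ((Fin.ofNat (n + 1) e : Fin (n + 1)) : ℕ) = e := by
      simpa using Nat.mod_eq_of_lt (by omega : e < n + 1)
    simp only [List.map_cons, List.map_nil, List.foldl_cons, List.foldl_nil]
    rcases Nat.eq_zero_or_pos e with h0 | h0
    · rw [hop_apply_of_eq_zero _ (hval.trans h0)]
      split_ifs with h
      · rfl
      · exact ih (by omega) j (by omega)
    · have h0' : ((Fin.ofNat (n + 1) e : Fin (n + 1)) : ℕ) ≠ 0 := by omega
      have hn' : ((Fin.ofNat (n + 1) e : Fin (n + 1)) : ℕ) ≠ n := by omega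
      by_cases hy : y ⟨((Fin.ofNat (n + 1) e : Fin (n + 1)) : ℕ) - 1, by omega⟩ = true ∧
          y ⟨((Fin.ofNat (n + 1) e : Fin (n + 1)) : ℕ), by omega⟩ = false
      · rw [hop_apply_of_free _ h0' hn' hy, hval, if_neg (by omega)]
        split_ifs with h
        · rfl
        · exact ih (by omega) j (by omega)
      · rw [hop_of_blocked _ h0' hn' hy]
        rcases hj with hj | hj
        · exact ih (by omega) j (Or.inl hj)
        · have hprev : y ⟨((Fin.ofNat (n + 1) e : Fin (n + 1)) : ℕ) - 1, by omega⟩ = true :=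
            ih (by omega) _ (Or.inr (by simp only [hval]; omega))
          have hje : j = ⟨((Fin.ofNat (n + 1) e : Fin (n + 1)) : ℕ), by omega⟩ :=
            Fin.ext (by simp only [hval]; omega)
          rw [hje]
          exact Bool.eq_true_of_not_eq_false fun h => hy ⟨hprev, h⟩

/-- Each sweep adds one site to the filled right end, so the next sweep can be one clock shorter. -/
theorem foldl_hop_fillWord (d : ℕ) (hd : d ≤ n) (x : Config n)
    (hx : ∀ j : Fin n, d ≤ (j : ℕ) → x j = true) (j : Fin n) :
    (fillWord n d).foldl hop x j = true := by
  induction d generalizing x with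
  | zero => exact hx j (Nat.zero_le _)
  | succ d ih =>
    rw [fillWord, List.foldl_append]
    exact ih (by omega) _ fun i hi =>
      foldl_hop_range x (d + 1) (d + 1) hd le_rfl hx i (by omega)

/-- All clocks of the word `fillWord n n` together lead to the fully occupied configuration. -/
theorem foldl_hop_fillWord_eq (x : Config n) :
    (fillWord n n).foldl hop x = (fun _ => true : Fin n → Bool) :=
  funext fun j => foldl_hop_fillWord n le_rfl x (fun i hi => absurd i.2 (by omega)) j

end Hop

/-! ### The flow -/

section Flow

variable {n : ℕ} {Ω : Type*} {jumps : Fin (n + 1) → Ω → Set ℝ}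

theorem finite_jumpSet (hfin : ∀ k ω a b, (jumps k ω ∩ Set.Icc a b).Finite) (t t₀ : ℝ) (ω : Ω) :
    (jumpSet jumps t t₀ ω).Finite := by
  refine (Set.finite_iUnion fun k => (hfin k ω t₀ t).image fun s => toLex (s, k)).subset ?_
  rintro e ⟨he, he'⟩
  exact Set.mem_iUnion.2 ⟨(ofLex e).2, (ofLex e).1, ⟨he', he.1, he.2.le⟩, rfl⟩

theorem flow_congr {t t₀ t' t₀' : ℝ} {ω : Ω}
    (h : jumpSet jumps t t₀ ω = jumpSet jumps t' t₀' ω) (x : Config n) :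
    flow jumps t t₀ x ω = flow jumps t' t₀' x ω := by
  unfold flow jumpList
  rw [h]

theorem flow_of_jumpSet_eq_empty {t t₀ : ℝ} {ω : Ω} (h : jumpSet jumps t t₀ ω = ∅)
    (x : Config n) : flow jumps t t₀ x ω = x := by
  unfold flow jumpList
  rw [h]
  simp

theorem jumpSet_of_le {t t₀ : ℝ} (h : t ≤ t₀) (ω : Ω) : jumpSet jumps t t₀ ω = ∅ := by
  ext e
  simp [jumpSet, h]

theorem flow_of_le {t t₀ : ℝ} (h : t ≤ t₀) (x : Config n) (ω : Ω) : flow jumps t t₀ x ω = x :=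
  flow_of_jumpSet_eq_empty (jumpSet_of_le h ω) x

theorem mem_jumpList (hfin : ∀ k ω a b, (jumps k ω ∩ Set.Icc a b).Finite) {t t₀ : ℝ} {ω : Ω}
    {e : ℝ ×ₗ Fin (n + 1)} : e ∈ jumpList jumps t t₀ ω ↔ e ∈ jumpSet jumps t t₀ ω := by
  rw [jumpList, dif_pos (finite_jumpSet hfin t t₀ ω)]
  simp

theorem nodup_jumpList (t t₀ : ℝ) (ω : Ω) : (jumpList jumps t t₀ ω).Nodup := by
  unfold jumpList
  split_ifs
  · exact Finset.sort_nodup _ _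
  · exact List.nodup_nil

theorem pairwise_jumpList (t t₀ : ℝ) (ω : Ω) :
    (jumpList jumps t t₀ ω).Pairwise (· ≤ ·) := by
  unfold jumpList
  split_ifs
  · exact Finset.pairwise_sort _ _
  · exact List.Pairwise.nil

/-- Both sides are sorted lists without repetition and have the same elements. -/
theorem jumpList_append (hfin : ∀ k ω a b, (jumps k ω ∩ Set.Icc a b).Finite) {t s t₀ : ℝ}
    (h₁ : t₀ ≤ s) (h₂ : s ≤ t) (ω : Ω) :
    jumpList jumps t t₀ ω = jumpList jumps s t₀ ω ++ jumpList jumps t s ω := by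
  have hlt : ∀ a ∈ jumpList jumps s t₀ ω, ∀ b ∈ jumpList jumps t s ω, a < b := by
    intro a ha b hb
    rw [mem_jumpList hfin] at ha hb
    exact Prod.Lex.lt_iff.2 (Or.inl (ha.1.2.trans_le hb.1.1))
  refine List.Perm.eq_of_pairwise (le := (· ≤ ·)) (fun _ _ _ _ => le_antisymm)
    (pairwise_jumpList t t₀ ω)
    (List.pairwise_append.2 ⟨pairwise_jumpList _ _ _, pairwise_jumpList _ _ _,
      fun a ha b hb => (hlt a ha b hb).le⟩) ?_
  refine (List.perm_ext_iff_of_nodup (nodup_jumpList _ _ _)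
    (List.nodup_append.2 ⟨nodup_jumpList _ _ _, nodup_jumpList _ _ _,
      fun a ha b hb => (hlt a ha b hb).ne⟩)).2 fun e => ?_
  rw [List.mem_append, mem_jumpList hfin, mem_jumpList hfin, mem_jumpList hfin]
  constructor
  · rintro ⟨⟨h, h'⟩, he⟩
    rcases lt_or_ge (ofLex e).1 s with hs | hs
    · exact Or.inl ⟨⟨h, hs⟩, he⟩
    · exact Or.inr ⟨⟨hs, h'⟩, he⟩
  · rintro (⟨⟨h, h'⟩, he⟩ | ⟨⟨h, h'⟩, he⟩)
    · exact ⟨⟨h, h'.trans_le h₂⟩, he⟩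
    · exact ⟨⟨h₁.trans h, h'⟩, he⟩

theorem flow_cocycle (hfin : ∀ k ω a b, (jumps k ω ∩ Set.Icc a b).Finite) {t s t₀ : ℝ}
    (h₁ : t₀ ≤ s) (h₂ : s ≤ t) (x : Config n) (ω : Ω) :
    flow jumps t t₀ x ω = flow jumps t s (flow jumps s t₀ x ω) ω := by
  unfold flow
  rw [jumpList_append hfin h₁ h₂, List.foldl_append]

theorem flow_eq_hop (hfin : ∀ k ω a b, (jumps k ω ∩ Set.Icc a b).Finite) {t t₀ : ℝ} {ω : Ω}
    {k : Fin (n + 1)} (hk : (jumps k ω ∩ Set.Ico t₀ t).Nonempty)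
    (h : ∀ l, l ≠ k → jumps l ω ∩ Set.Ico t₀ t = ∅) (x : Config n) :
    flow jumps t t₀ x ω = hop x k := by
  refine foldl_hop_of_forall_eq (fun e : ℝ ×ₗ Fin (n + 1) => (ofLex e).2) k _ ?_ ?_ x
  · obtain ⟨s, hs, hs'⟩ := hk
    exact List.ne_nil_of_mem ((mem_jumpList hfin (e := toLex (s, k))).2 ⟨hs', hs⟩)
  · intro e he
    obtain ⟨he, he'⟩ := (mem_jumpList hfin).1 he
    by_contra hne
    exact (h _ hne).subset ⟨he', he⟩

/-- In each window exactly one clock is active, so the flow across it is a single `hop`; the cocycle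
property composes the windows. -/
theorem flow_eq_foldl (hfin : ∀ k ω a b, (jumps k ω ∩ Set.Icc a b).Finite) {m : ℕ}
    {q : Fin (m + 1) → ℝ} (hq : Monotone q) (w : Fin m → Fin (n + 1)) {ω : Ω}
    (hw : ∀ i k, (jumps k ω ∩ Set.Ico (q i.castSucc) (q i.succ)).Nonempty ↔ k = w i)
    (x : Config n) :
    flow jumps (q (Fin.last m)) (q 0) x ω = (List.ofFn w).foldl hop x := by
  induction m with
  | zero => simpa using flow_of_le le_rfl x ω
  | succ m ih =>
    have h := ih (q := fun i => q i.castSucc) (fun i j hij => hq (by simpa using hij))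
      (fun i => w i.castSucc) (fun i k => hw i.castSucc k)
    rw [List.ofFn_succ', List.concat_eq_append, List.foldl_append, ← h,
      flow_cocycle hfin (s := q (Fin.last m).castSucc) (hq (Fin.zero_le _))
        (hq (Fin.le_last _)) x ω]
    refine flow_eq_hop hfin ((hw (Fin.last m) _).2 rfl) (fun l hl => ?_) _
    exact Set.not_nonempty_iff_eq_empty.1 fun hne => hl ((hw (Fin.last m) l).1 hne)

end Flow

end TASEP

/-! ### Attractors of systems with finitely many states -/

section Finite

theorem semiDist_self {X : Type*} [MetricSpace X] (A : Set X) : semiDist A A = 0 := by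
  simp only [semiDist, ENNReal.iSup_eq_zero]
  exact fun a ha => le_antisymm ((iInf₂_le a ha).trans (edist_self a).le) zero_le

theorem attractorSet_subset {X Ω : Type*} {φ : ℝ → ℝ → X → Ω → X} {t t₀ : ℝ} (h : t₀ ≤ t) (ω : Ω) :
    attractorSet φ t ω ⊆ imageSet φ t t₀ Set.univ ω :=
  Set.biInter_subset_of_mem h


variable {X Ω : Type*} [MetricSpace X] [MeasurableSpace X] [PolishSpace X] [BorelSpace X]
  [MeasurableSpace Ω] {φ : ℝ → ℝ → X → Ω → X}

theorem IsNRDS.imageSet_imageSet (h : IsNRDS φ) {t s t₀ : ℝ} (h₁ : t₀ ≤ s) (h₂ : s ≤ t)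
    (B : Set X) (ω : Ω) : imageSet φ t s (imageSet φ s t₀ B ω) ω = imageSet φ t t₀ B ω := by
  simp only [imageSet, Set.image_image]
  exact Set.image_congr fun x _ => (h.cocycle t s t₀ h₁ h₂ x ω).symm

theorem IsNRDS.imageSet_univ_anti (h : IsNRDS φ) {t s t₀ : ℝ} (h₁ : t₀ ≤ s) (h₂ : s ≤ t) (ω : Ω) :
    imageSet φ t t₀ Set.univ ω ⊆ imageSet φ t s Set.univ ω := by
  rw [← h.imageSet_imageSet h₁ h₂]
  exact Set.image_mono (Set.subset_univ _)

/-- If there are only finitely many states, then the pullback images are eventually equal to the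
attractor. -/
theorem IsNRDS.exists_imageSet_eq_attractorSet [Finite X] (h : IsNRDS φ) (t : ℝ) (ω : Ω) :
    ∃ s ≤ t, ∀ s' ≤ s, imageSet φ t s' Set.univ ω = attractorSet φ t ω := by
  -- Choose a starting time whose image has the fewest points. Earlier images are subsets of it and
  -- cannot be smaller, so they coincide with it.
  obtain ⟨s, hs, hmin⟩ := (InvImage.wf (fun s => (imageSet φ t s Set.univ ω).ncard)
    wellFounded_lt).has_min (Set.Iic t) ⟨t, Set.mem_Iic.2 le_rfl⟩
  have hst : ∀ s' ≤ s, imageSet φ t s' Set.univ ω = imageSet φ t s Set.univ ω := fun s' hs' =>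
    Set.eq_of_subset_of_ncard_le (h.imageSet_univ_anti hs' hs ω)
      (not_lt.1 (hmin s' (hs'.trans hs))) (Set.toFinite _)
  refine ⟨s, hs, fun s' hs' => (hst s' hs').trans
    (subset_antisymm (Set.subset_iInter₂ fun t₀ ht₀ => ?_) (attractorSet_subset hs ω))⟩
  rw [← hst (min s t₀) (min_le_left _ _)]
  exact h.imageSet_univ_anti (min_le_right _ _) ht₀ ω

theorem IsNRDS.attractorSet_nonempty [Finite X] [Nonempty X] (h : IsNRDS φ) (t : ℝ) (ω : Ω) :
    (attractorSet φ t ω).Nonempty := by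
  obtain ⟨s, -, hs⟩ := h.exists_imageSet_eq_attractorSet t ω
  rw [← hs s le_rfl]
  exact Set.univ_nonempty.image _

theorem IsNRDS.imageSet_attractorSet [Finite X] (h : IsNRDS φ) {t t₀ : ℝ} (ht : t₀ ≤ t) (ω : Ω) :
    imageSet φ t t₀ (attractorSet φ t₀ ω) ω = attractorSet φ t ω := by
  obtain ⟨s, hs, hs'⟩ := h.exists_imageSet_eq_attractorSet t ω
  obtain ⟨u, hu, hu'⟩ := h.exists_imageSet_eq_attractorSet t₀ ω
  -- A common early starting time represents both attractor sections as images of the whole space.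
  rw [← hs' (min s u) (min_le_left _ _), ← hu' (min s u) (min_le_right _ _),
    h.imageSet_imageSet ((min_le_right _ _).trans hu) ht]

theorem IsNRDS.measurable_apply (h : IsNRDS φ) {t t₀ : ℝ} (ht : t₀ ≤ t) (x : X) :
    Measurable (φ t t₀ x) :=
  h.measurable.comp (measurable_const (a := (⟨(t, t₀), ht⟩ : {q : ℝ × ℝ // q.2 ≤ q.1})).prodMk
    (measurable_const.prodMk measurable_id))

/-- By monotonicity in the starting time, the intersection may be restricted to the countably many
times `t - N`. -/
theorem IsNRDS.measurableSet_attractorSet [Finite X] (h : IsNRDS φ) (t : ℝ) :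
    MeasurableSet {p : X × Ω | p.1 ∈ attractorSet φ t p.2} := by
  have heq : {p : X × Ω | p.1 ∈ attractorSet φ t p.2} =
      ⋂ N : ℕ, ⋃ (x : X) (y : X), {x} ×ˢ {ω | φ t (t - N) y ω = x} := by
    ext ⟨x, ω⟩
    have hx : x ∈ attractorSet φ t ω ↔ ∀ N : ℕ, x ∈ imageSet φ t (t - N) Set.univ ω := by
      refine ⟨fun hx N => attractorSet_subset (by simp) ω hx, fun hx => ?_⟩
      refine Set.mem_iInter₂.2 fun t₀ ht₀ => ?_
      obtain ⟨N, hN⟩ := exists_nat_ge (t - t₀)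
      exact h.imageSet_univ_anti (by linarith) ht₀ ω (hx N)
    simp only [Set.mem_ofPred_eq, hx, Set.mem_iInter]
    refine forall_congr' fun N => ?_
    simp [imageSet]
  rw [heq]
  exact .iInter fun N => .iUnion fun x => .iUnion fun y => (measurableSet_singleton x).prod
    (h.measurable_apply (by simp) y (measurableSet_singleton x))

theorem IsNRDS.isInvariantRandomSet_attractorSet [Finite X] (h : IsNRDS φ) (P : Measure Ω) :
    IsInvariantRandomSet P φ (attractorSet φ) where
  measurableSet := h.measurableSet_attractorSet
  isCompact _ _ := (Set.toFinite _).isCompact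
  invariant := .of_forall fun ω _ _ ht => h.imageSet_attractorSet ht ω

theorem IsNRDS.isPullbackAttractor_attractorSet [Finite X] (h : IsNRDS φ) (P : Measure Ω) :
    IsPullbackAttractor P φ (attractorSet φ) where
  toIsInvariantRandomSet := h.isInvariantRandomSet_attractorSet P
  attracts t := .of_forall fun ω => by
    obtain ⟨s, -, hs⟩ := h.exists_imageSet_eq_attractorSet t ω
    refine tendsto_const_nhds.congr' ?_
    filter_upwards [eventually_le_atBot s] with t₀ ht₀
    rw [hs t₀ ht₀, semiDist_self]

/-- Solutions that have merged stay merged, and an earlier start only restricts the states present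
at time `u`. -/
theorem IsNRDS.syncEvent_subset (h : IsNRDS φ) {t s u t₀ : ℝ} (h₁ : t₀ ≤ u) (h₂ : u ≤ s)
    (h₃ : s ≤ t) : syncEvent φ s u ⊆ syncEvent φ t t₀ := fun ω hω x₁ x₂ => by
  rw [h.cocycle t s t₀ (h₁.trans h₂) h₃, h.cocycle s u t₀ h₁ h₂, h.cocycle t s t₀ (h₁.trans h₂) h₃,
    h.cocycle s u t₀ h₁ h₂ x₂, hω]

theorem IsNRDS.attractorSet_eq_of_mem_syncEvent [Finite X] [Nonempty X] (h : IsNRDS φ)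
    {t t₀ : ℝ} (ht : t₀ ≤ t) {ω : Ω} (hω : ω ∈ syncEvent φ t t₀) (x : X) :
    attractorSet φ t ω = {φ t t₀ x ω} ∧ imageSet φ t t₀ Set.univ ω = {φ t t₀ x ω} := by
  have him : imageSet φ t t₀ Set.univ ω = {φ t t₀ x ω} := by
    refine (Set.univ_nonempty.image _).subset_singleton_iff.1 ?_
    rintro _ ⟨y, -, rfl⟩
    exact hω y x
  refine ⟨(h.attractorSet_nonempty t ω).subset_singleton_iff.1 ?_, him⟩
  rw [← him]
  exact attractorSet_subset ht ω

theorem IsNRDS.isForwardAttractor_attractorSet [Finite X] [Nonempty X] (h : IsNRDS φ)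
    (P : Measure Ω) (hsync : ∀ t₀, ∀ᵐ ω ∂P, ∃ t, t₀ ≤ t ∧ ω ∈ syncEvent φ t t₀) :
    IsForwardAttractor P φ (attractorSet φ) where
  toIsInvariantRandomSet := h.isInvariantRandomSet_attractorSet P
  attracts t₀ := by
    filter_upwards [hsync t₀] with ω ⟨s, hs, hω⟩
    refine tendsto_const_nhds.congr' ?_
    filter_upwards [eventually_ge_atTop s] with t ht
    obtain ⟨h₁, h₂⟩ := h.attractorSet_eq_of_mem_syncEvent (hs.trans ht)
      (h.syncEvent_subset le_rfl hs ht hω) (Classical.arbitrary X)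
    rw [h₁, h₂, semiDist_self]

end Finite

/-! ### Counts of Poisson processes on intervals -/

section Counts

variable {Ω : Type*} {lam : ℝ → ℝ} {S : Ω → Set ℝ}

theorem pointCount_ne_zero {A : Set ℝ} {ω : Ω} :
    pointCount S A ω ≠ 0 ↔ (S ω ∩ A).Nonempty :=
  Set.encard_ne_zero

theorem cumRate_sub (hint : LocallyIntegrable lam volume) (a b : ℝ) :
    cumRate lam b - cumRate lam a = ∫ s in a..b, lam s :=
  intervalIntegral.integral_interval_sub_left (intervalIntegrable_iff.2 <|
    (hint.integrableOn_isCompact isCompact_uIcc).mono_set Set.uIoc_subset_uIcc)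
    (intervalIntegrable_iff.2 <|
      (hint.integrableOn_isCompact isCompact_uIcc).mono_set Set.uIoc_subset_uIcc)

theorem cumRate_mono (hint : LocallyIntegrable lam volume) (hnn : ∀ t, 0 ≤ lam t) :
    Monotone (cumRate lam) := fun a b hab => by
  rw [← sub_nonneg, cumRate_sub hint]
  exact intervalIntegral.integral_nonneg hab fun t _ => hnn t

/-- The count of a non-homogeneous process on `[a, b)` is the count of the associated homogeneous
process on `[M(a), M(b))`. -/
theorem pointCount_image_cumRate (hM : Monotone (cumRate lam))
    (hflat : ∀ ω, ∀ s ∈ S ω, ∀ t, cumRate lam t = cumRate lam s → t = s) (a b : ℝ) :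
    pointCount (fun ω => cumRate lam '' S ω) (Set.Ico (cumRate lam a) (cumRate lam b)) =
      pointCount S (Set.Ico a b) := by
  funext ω
  have himage : (cumRate lam '' S ω) ∩ Set.Ico (cumRate lam a) (cumRate lam b) =
      cumRate lam '' (S ω ∩ Set.Ico a b) := by
    ext y
    constructor
    · rintro ⟨⟨s, hs, rfl⟩, h₁, h₂⟩
      refine ⟨s, ⟨hs, ?_, hM.reflect_lt h₂⟩, rfl⟩
      -- A point before `a` whose image is at least `M(a)` would lie on a flat piece of `M`, which
      -- `hflat` excludes.
      by_contra! hsa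
      exact hsa.ne' (hflat ω s hs a (le_antisymm h₁ (hM hsa.le)))
    · rintro ⟨s, ⟨hs, h₁, h₂⟩, rfl⟩
      refine ⟨⟨s, hs, rfl⟩, hM h₁, lt_of_le_of_ne (hM h₂.le) fun heq => ?_⟩
      exact h₂.ne' (hflat ω s hs b heq.symm)
  have hinj : Set.InjOn (cumRate lam) (S ω ∩ Set.Ico a b) := fun s _ s' hs' heq =>
    hflat ω s' hs'.1 s heq
  simp only [pointCount]
  rw [himage, hinj.encard_image]

theorem IsPoisson.measurable_pointCount_Ico [MeasurableSpace Ω] {P : Measure Ω}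
    (h : IsPoisson P lam S) (hflat : ∀ ω, ∀ s ∈ S ω, ∀ t, cumRate lam t = cumRate lam s → t = s) (a b : ℝ) :
    Measurable (pointCount S (Set.Ico a b)) := by
  rw [← pointCount_image_cumRate (cumRate_mono h.locallyIntegrable h.nonneg) hflat]
  exact h.timeChange.measurable _ measurableSet_Ico

end Counts

/-! ### Measurability of the flow -/

namespace TASEP

variable {n : ℕ} {Ω : Type*} {jumps : Fin (n + 1) → Ω → Set ℝ}

open Classical in
/-- Carry out a jump attempt of an active clock, if there is one. -/
noncomputable def hopActive (v : Fin (n + 1) → Bool) (x : Config n) : Config n :=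
  if h : ∃ k, v k = true then hop x h.choose else x

/-- The clocks that ring in `[a, b)`. -/
noncomputable def activity (jumps : Fin (n + 1) → Ω → Set ℝ) (a b : ℝ) (ω : Ω) (k : Fin (n + 1)) : Bool :=
  decide (pointCount (jumps k) (Set.Ico a b) ω ≠ 0)

/-- The approximation of the flow in which at most one jump attempt is carried out in each of the
intervals `[q i, q (i + 1))`. -/
noncomputable def gridFlow (jumps : Fin (n + 1) → Ω → Set ℝ) (q : ℕ → ℝ) (x : Config n) (ω : Ω) : ℕ → Config n
  | 0 => x
  | N + 1 => hopActive (activity jumps (q N) (q (N + 1)) ω) (gridFlow jumps q x ω N)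

theorem activity_eq_true {a b : ℝ} {ω : Ω} {k : Fin (n + 1)} :
    activity jumps a b ω k = true ↔ (jumps k ω ∩ Set.Ico a b).Nonempty := by
  rw [activity, decide_eq_true_iff, pointCount_ne_zero]

/-- With at most one jump attempt, the arbitrary choice in `hopActive` can only pick the right
clock. -/
theorem flow_eq_hopActive (hfin : ∀ k ω a b, (jumps k ω ∩ Set.Icc a b).Finite) {a b : ℝ} {ω : Ω}
    (h : (jumpSet jumps b a ω).Subsingleton) (x : Config n) :
    flow jumps b a x ω = hopActive (activity jumps a b ω) x := by
  unfold hopActive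
  split_ifs with hex
  · have hk := activity_eq_true.1 hex.choose_spec
    refine flow_eq_hop hfin hk (fun l hl => ?_) x
    by_contra hne
    obtain ⟨s, hs, hs'⟩ := Set.nonempty_iff_ne_empty.2 hne
    obtain ⟨u, hu, hu'⟩ := hk
    exact hl (congrArg (fun e => (ofLex e).2)
      (h (show toLex (s, l) ∈ jumpSet jumps b a ω from ⟨hs', hs⟩)
        (show toLex (u, hex.choose) ∈ jumpSet jumps b a ω from ⟨hu', hu⟩)))
  · refine flow_of_jumpSet_eq_empty (Set.eq_empty_of_forall_notMem fun e he => hex ?_) x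
    exact ⟨(ofLex e).2, activity_eq_true.2 ⟨(ofLex e).1, he.2, he.1⟩⟩

theorem flow_eq_gridFlow (hfin : ∀ k ω a b, (jumps k ω ∩ Set.Icc a b).Finite) {q : ℕ → ℝ}
    (hq : Monotone q) {ω : Ω} (h : ∀ i, (jumpSet jumps (q (i + 1)) (q i) ω).Subsingleton)
    (x : Config n) (N : ℕ) : flow jumps (q N) (q 0) x ω = gridFlow jumps q x ω N := by
  induction N with
  | zero => exact flow_of_le le_rfl x ω
  | succ N ih =>
    rw [gridFlow, ← ih, ← flow_eq_hopActive hfin (h N),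
      flow_cocycle hfin (hq (Nat.zero_le N)) (hq (Nat.le_succ N))]

theorem time_ne_of_mem_jumpSet (hdisj : ∀ ω, Pairwise fun k l => Disjoint (jumps k ω) (jumps l ω))
    {a b : ℝ} {ω : Ω} {e e' : ℝ ×ₗ Fin (n + 1)} (he : e ∈ jumpSet jumps b a ω)
    (he' : e' ∈ jumpSet jumps b a ω) (hne : e ≠ e') : (ofLex e).1 ≠ (ofLex e').1 := by
  intro heq
  by_cases hk : (ofLex e).2 = (ofLex e').2
  · exact hne (ofLex.injective (Prod.ext heq hk))
  · exact Set.disjoint_left.1 (hdisj ω hk) he.2 (heq ▸ he'.2)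

/-- The finitely many jump times are distinct, so once the mesh is below their smallest gap each
cell contains at most one. Capping the grid at `t` leaves the cells after the last one empty. -/
theorem eventually_flow_eq_gridFlow (hfin : ∀ k ω a b, (jumps k ω ∩ Set.Icc a b).Finite)
    (hdisj : ∀ ω, Pairwise fun k l => Disjoint (jumps k ω) (jumps l ω)) {t t₀ : ℝ} (ht : t₀ < t)
    (x : Config n) (ω : Ω) :
    ∀ᶠ N : ℕ in atTop, gridFlow jumps (fun i => min (t₀ + i * ((t - t₀) / (N + 1))) t) x ω (N + 1)
      = flow jumps t t₀ x ω := by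
  have hlim : Tendsto (fun N : ℕ => (t - t₀) / ((N : ℝ) + 1)) atTop (𝓝 0) := by
    simpa [div_eq_mul_inv] using (tendsto_one_div_add_atTop_nhds_zero_nat (𝕜 := ℝ)).const_mul (t - t₀)
  have hsep : ∀ᶠ N : ℕ in atTop, ∀ p ∈ jumpSet jumps t t₀ ω ×ˢ jumpSet jumps t t₀ ω, p.1 ≠ p.2 →
      (t - t₀) / ((N : ℝ) + 1) < |(ofLex p.1).1 - (ofLex p.2).1| := by
    refine (eventually_all_finite ((finite_jumpSet hfin t t₀ ω).prod
      (finite_jumpSet hfin t t₀ ω))).2 fun p hp => ?_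
    by_cases hne : p.1 = p.2
    · exact .of_forall fun _ h => absurd hne h
    · filter_upwards [hlim.eventually_lt_const (abs_pos.2 (sub_ne_zero.2
        (time_ne_of_mem_jumpSet hdisj hp.1 hp.2 hne)))] with N hN _ using hN
  filter_upwards [hsep] with N hN
  have hpos : 0 < (t - t₀) / ((N : ℝ) + 1) := div_pos (sub_pos.2 ht) (by positivity)
  set δ := (t - t₀) / ((N : ℝ) + 1) with hδ
  set q : ℕ → ℝ := fun i => min (t₀ + i * δ) t with hq
  have hmono : Monotone q := fun i j hij => min_le_min_right _ (by
    have : (i : ℝ) ≤ j := by exact_mod_cast hij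
    gcongr)
  have hq0 : q 0 = t₀ := by simp [hq, ht.le]
  have hqN : q (N + 1) = t := by
    have : ((N : ℝ) + 1) * δ = t - t₀ := by rw [hδ]; field_simp
    simp [hq, this]
  rw [← flow_eq_gridFlow hfin hmono (fun i e he e' he' => ?_) x (N + 1), hqN, hq0]
  by_contra hne
  have hlow : t₀ ≤ q i := hq0 ▸ hmono (Nat.zero_le i)
  have hup : q (i + 1) ≤ t := min_le_right _ _
  have hstep : q (i + 1) ≤ q i + δ := by
    simp only [hq, min_add]
    refine min_le_min ?_ (by linarith)
    push_cast
    linarith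
  have := hN (e, e') ⟨⟨⟨hlow.trans he.1.1, he.1.2.trans_le hup⟩, he.2⟩,
    ⟨hlow.trans he'.1.1, he'.1.2.trans_le hup⟩, he'.2⟩ hne
  rw [lt_abs] at this
  have h₁ := he.1.1
  have h₂ := he.1.2
  have h₃ := he'.1.1
  have h₄ := he'.1.2
  rcases this with h | h <;> simp only at h <;> linarith

/-- The largest multiple of `1 / (N + 1)` that is smaller than `t`. -/
noncomputable def gridBelow (N : ℕ) (t : ℝ) : ℝ := (⌈t * (N + 1)⌉ - 1) / (N + 1)

theorem gridBelow_lt (N : ℕ) (t : ℝ) : gridBelow N t < t := by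
  rw [gridBelow, div_lt_iff₀ (by positivity)]
  linarith [Int.ceil_lt_add_one (t * (N + 1))]

theorem le_gridBelow (N : ℕ) (t : ℝ) : t - 1 / (N + 1) ≤ gridBelow N t := by
  rw [gridBelow, le_div_iff₀ (by positivity), sub_mul, one_div_mul_cancel (by positivity)]
  linarith [Int.le_ceil (t * (N + 1))]

theorem tendsto_gridBelow (t : ℝ) : Tendsto (fun N => gridBelow N t) atTop (𝓝 t) := by
  refine tendsto_of_tendsto_of_tendsto_of_le_of_le ?_ tendsto_const_nhds
    (fun N => le_gridBelow N t) (fun N => (gridBelow_lt N t).le)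
  simpa using (tendsto_one_div_add_atTop_nhds_zero_nat (𝕜 := ℝ)).const_sub t

theorem eventually_jumpSet_gridBelow (hfin : ∀ k ω a b, (jumps k ω ∩ Set.Icc a b).Finite)
    (t t₀ : ℝ) (ω : Ω) :
    ∀ᶠ N in atTop, jumpSet jumps (gridBelow N t) (gridBelow N t₀) ω = jumpSet jumps t t₀ ω := by
  have hbelow : ∀ s s₀ : ℝ, ∀ᶠ N in atTop, ∀ e ∈ jumpSet jumps s s₀ ω,
      (ofLex e).1 < gridBelow N s := fun s s₀ =>
    (eventually_all_finite (finite_jumpSet hfin s s₀ ω)).2 fun e he =>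
      (tendsto_gridBelow s).eventually_const_lt he.1.2
  -- Grid points lie at most `1` below `t₀`, so only the finitely many jumps in `[t₀ - 1, t₀)` could
  -- wrongly enter.
  filter_upwards [hbelow t t₀, hbelow t₀ (t₀ - 1)] with N h₁ h₂
  ext e
  refine ⟨fun ⟨⟨hl, hu⟩, he⟩ => ⟨⟨?_, hu.trans (gridBelow_lt N t)⟩, he⟩,
    fun h => ⟨⟨(gridBelow_lt N t₀).le.trans h.1.1, h₁ e h⟩, h.2⟩⟩
  by_contra! hlt
  refine (h₂ e ⟨⟨?_, hlt⟩, he⟩).not_ge hl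
  have hN : 1 / ((N : ℝ) + 1) ≤ 1 := by
    rw [div_le_one (by positivity)]
    linarith [Nat.cast_nonneg (α := ℝ) N]
  linarith [le_gridBelow N t₀]

section Measurable

variable [MeasurableSpace Ω]

theorem measurable_gridFlow
    (hcount : ∀ k a b, Measurable (pointCount (jumps k) (Set.Ico a b))) (q : ℕ → ℝ) (x : Config n)
    (N : ℕ) : Measurable fun ω => gridFlow jumps q x ω N := by
  induction N with
  | zero => exact measurable_const
  | succ N ih =>
    have hact : Measurable (activity jumps (q N) (q (N + 1))) :=
      measurable_pi_lambda _ fun k =>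
        (Measurable.of_discrete (f := fun m : ℕ∞ => decide (m ≠ 0))).comp (hcount k _ _)
    exact (measurable_of_countable fun p : (Fin (n + 1) → Bool) × Config n =>
      hopActive p.1 p.2).comp (hact.prodMk ih)

theorem measurable_flow_apply (hfin : ∀ k ω a b, (jumps k ω ∩ Set.Icc a b).Finite)
    (hdisj : ∀ ω, Pairwise fun k l => Disjoint (jumps k ω) (jumps l ω))
    (hcount : ∀ k a b, Measurable (pointCount (jumps k) (Set.Ico a b))) (t t₀ : ℝ) (x : Config n) :
    Measurable (flow jumps t t₀ x) := by
  rcases le_or_gt t t₀ with ht | ht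
  · rw [show flow jumps t t₀ x = fun _ => x from funext fun ω => flow_of_le ht x ω]
    exact measurable_const
  · refine measurable_of_tendsto_metrizable
      (fun N => measurable_gridFlow hcount (fun i => min (t₀ + i * ((t - t₀) / (N + 1))) t) x (N + 1))
      (tendsto_pi_nhds.2 fun ω => ?_)
    exact tendsto_const_nhds.congr' ((eventually_flow_eq_gridFlow hfin hdisj ht x ω).mono
      fun N hN => hN.symm)

/-- Jumps are collected on `[t₀, t)`, so the flow is left-continuous in both times. Rounding the
times down to a grid therefore converges pointwise, and leaves only countably many time pairs to
treat. -/
theorem measurable_flow (hfin : ∀ k ω a b, (jumps k ω ∩ Set.Icc a b).Finite)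
    (hdisj : ∀ ω, Pairwise fun k l => Disjoint (jumps k ω) (jumps l ω))
    (hcount : ∀ k a b, Measurable (pointCount (jumps k) (Set.Ico a b))) :
    Measurable fun p : ℝ × ℝ × Config n × Ω => flow jumps p.1 p.2.1 p.2.2.1 p.2.2.2 := by
  refine measurable_of_tendsto_metrizable
    (f := fun N p => flow jumps (gridBelow N p.1) (gridBelow N p.2.1) p.2.2.1 p.2.2.2)
    (fun N => ?_) (tendsto_pi_nhds.2 fun p => ?_)
  · have hG : Measurable fun p : ℤ × ℤ × Config n × Ω =>
        flow jumps ((p.1 - 1) / (N + 1)) ((p.2.1 - 1) / (N + 1)) p.2.2.1 p.2.2.2 :=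
      measurable_from_prod_countable_right fun i => measurable_from_prod_countable_right fun j =>
        measurable_from_prod_countable_right fun x =>
          measurable_flow_apply hfin hdisj hcount ((i - 1) / (N + 1)) ((j - 1) / (N + 1)) x
    have hceil : Measurable fun t : ℝ => ⌈t * (N + 1)⌉ :=
      Int.measurable_ceil.comp (measurable_id.mul_const _)
    exact hG.comp ((hceil.comp measurable_fst).prodMk
      ((hceil.comp (measurable_fst.comp measurable_snd)).prodMk
        (measurable_snd.comp measurable_snd)))
  · exact tendsto_const_nhds.congr' ((eventually_jumpSet_gridBelow hfin p.1 p.2.1 p.2.2.2).mono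
      fun N hN => (flow_congr hN p.2.2.1).symm)

variable {P : Measure Ω} {lam : Fin (n + 1) → ℝ → ℝ}

theorem IsClockFamily.measurable_pointCount (h : IsClockFamily P lam jumps) (k : Fin (n + 1))
    (a b : ℝ) : Measurable (pointCount (jumps k) (Set.Ico a b)) :=
  (h.poisson k).measurable_pointCount_Ico (h.not_flat k) a b

theorem IsClockFamily.isNRDS_flow (h : IsClockFamily P lam jumps) : IsNRDS (flow jumps) where
  measurable := (measurable_flow h.finite h.disjoint h.measurable_pointCount).comp
    ((measurable_fst.comp (measurable_subtype_coe.comp measurable_fst)).prodMk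
      ((measurable_snd.comp (measurable_subtype_coe.comp measurable_fst)).prodMk measurable_snd))
  id_diag _ x ω := flow_of_le le_rfl x ω
  cocycle _ _ _ h₁ h₂ x ω := flow_cocycle h.finite h₁ h₂ x ω
  continuous _ _ _ _ := continuous_of_discreteTopology

end Measurable

end TASEP

/-! ### Independence of the counts -/

/-- Events that depend on disjoint groups of independent sigma-algebras are independent. -/
theorem ProbabilityTheory.iIndep.measure_iInter_range {Ω ι : Type*} {mΩ : MeasurableSpace Ω}
    {μ : Measure Ω} {m : ι → MeasurableSpace Ω} (hind : iIndep m μ) (hle : ∀ i, m i ≤ mΩ)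
    (g : ι → ℕ) {E : ℕ → Set Ω} (hE : ∀ j, MeasurableSet[⨆ (i) (_ : g i = j), m i] (E j)) (N : ℕ) :
    μ (⋂ j ∈ Finset.range N, E j) = ∏ j ∈ Finset.range N, μ (E j) := by
  have := hind.isProbabilityMeasure
  induction N with
  | zero => simp
  | succ N ih =>
    have hlow : MeasurableSet[⨆ i ∈ {i | g i < N}, m i] (⋂ j ∈ Finset.range N, E j) := by
      refine Finset.measurableSet_biInter _ fun j hj => ?_
      have hsup : (⨆ (i) (_ : g i = j), m i) ≤ ⨆ i ∈ {i | g i < N}, m i :=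
        iSup₂_le fun i hi => le_iSup₂ (f := fun i (_ : i ∈ {i | g i < N}) => m i) i
          (hi.trans_lt (Finset.mem_range.1 hj))
      exact hsup _ (hE j)
    have hsplit := (Indep_iff _ _ _).1 (indep_iSup_of_disjoint hle hind
      (S := {i | g i < N}) (T := {i | g i = N})
      (Set.disjoint_left.2 fun i hi hi' => hi.ne hi')) _ _ hlow (hE N)
    rw [Finset.prod_range_succ, ← ih, ← hsplit, Finset.range_add_one, Finset.set_biInter_insert,
      Set.inter_comm]

section PoissonLaw

variable {Ω : Type*} [MeasurableSpace Ω] {P : Measure Ω} {lam : ℝ → ℝ} {S : Ω → Set ℝ}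

theorem IsPoisson.measure_pointCount_Ico_eq_zero (h : IsPoisson P lam S)
    (hflat : ∀ ω, ∀ s ∈ S ω, ∀ t, cumRate lam t = cumRate lam s → t = s) {a b : ℝ} (hab : a ≤ b) :
    P {ω | pointCount S (Set.Ico a b) ω = 0} =
      ENNReal.ofReal (Real.exp (-∫ s in a..b, lam s)) := by
  have hM := cumRate_mono h.locallyIntegrable h.nonneg
  have hp := h.timeChange.poisson (Set.Ico (cumRate lam a) (cumRate lam b)) measurableSet_Ico
    (by simp) 0
  rw [pointCount_image_cumRate hM hflat] at hp
  simpa [Real.volume_real_Ico_of_le (hM hab), cumRate_sub h.locallyIntegrable] using hp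

theorem IsPoisson.iIndepFun_pointCount_Ico (h : IsPoisson P lam S)
    (hflat : ∀ ω, ∀ s ∈ S ω, ∀ t, cumRate lam t = cumRate lam s → t = s) {ι : Type*} {a b : ι → ℝ}
    (hdisj : Pairwise (Function.onFun Disjoint fun i => Set.Ico (a i) (b i))) :
    iIndepFun (fun i => pointCount S (Set.Ico (a i) (b i))) P := by
  have hM := cumRate_mono h.locallyIntegrable h.nonneg
  simp_rw [← pointCount_image_cumRate hM hflat]
  -- Independence is assumed only for families indexed by `Fin p`, so pass to a finite subfamily and
  -- enumerate it.
  refine iIndepFun_iff_finset.2 fun s => ?_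
  refine (iIndepFun_precomp_of_bijective (g := s.equivFin.symm) s.equivFin.symm.bijective).1 ?_
  refine h.timeChange.indep s.card
    (fun i => Set.Ico (cumRate lam (a (s.equivFin.symm i))) (cumRate lam (b (s.equivFin.symm i))))
    (fun _ => measurableSet_Ico) fun i j hij => Set.disjoint_left.2 ?_
  rintro y ⟨h₁, h₂⟩ ⟨h₃, h₄⟩
  have hne : (s.equivFin.symm i : ι) ≠ s.equivFin.symm j := fun heq =>
    hij (s.equivFin.symm.injective (Subtype.ext heq))
  have hlt : ∀ {c d : ℝ}, cumRate lam c ≤ y → y < cumRate lam d → c < d := fun hc hd =>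
    hM.reflect_lt (hc.trans_lt hd)
  -- If two image intervals met, the larger of the two left endpoints would lie in both original
  -- intervals.
  exact Set.disjoint_left.1 (hdisj hne)
    ⟨le_max_left _ _, max_lt (hlt h₁ h₂) (hlt h₃ h₂)⟩
    ⟨le_max_right _ _, max_lt (hlt h₁ h₄) (hlt h₃ h₄)⟩

end PoissonLaw

/-! ### Ringing patterns and almost sure synchronization. -/

namespace TASEP

variable {n : ℕ} {Ω : Type*} [MeasurableSpace Ω] {P : Measure Ω} {lam : Fin (n + 1) → ℝ → ℝ}
  {jumps : Fin (n + 1) → Ω → Set ℝ}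

/-- The counts of all clocks on pairwise disjoint intervals are independent. -/
theorem IsClockFamily.iIndepFun_pointCount (h : IsClockFamily P lam jumps) {ι : Type*}
    {a b : ι → ℝ} (hdisj : Pairwise (Function.onFun Disjoint fun i => Set.Ico (a i) (b i))) :
    iIndepFun (fun (p : Fin (n + 1) × ι) => pointCount (jumps p.1) (Set.Ico (a p.2) (b p.2))) P := by
  refine iIndepFun_uncurry' (X := fun k i => pointCount (jumps k) (Set.Ico (a i) (b i)))
    (fun k i => h.measurable_pointCount k _ _) ?_
    fun k => (h.poisson k).iIndepFun_pointCount_Ico (h.not_flat k) hdisj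
  rw [iIndepFun_iff_iIndep, iIndep_iff]
  intro s f hf
  refine h.indep.meas_biInter fun k hk => ?_
  refine Measurable.comap_le ?_ _ (hf k hk)
  refine @measurable_pi_lambda _ _ _ (pointSigma (jumps k)) _ _ fun i => ?_
  exact Measurable.of_comap_le (le_iSup (fun A : {A : Set ℝ // MeasurableSet A} =>
    MeasurableSpace.comap (pointCount (jumps k) A.1) inferInstance) ⟨_, measurableSet_Ico⟩)

/-- The event that, for each `i`, the clock `w i` rings in `[q i, q (i + 1))` and all other clocks
do not. -/
def ringEvent (jumps : Fin (n + 1) → Ω → Set ℝ) {m : ℕ} (w : Fin m → Fin (n + 1))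
    (q : Fin (m + 1) → ℝ) : Set Ω :=
  ⋂ p : Fin (n + 1) × Fin m,
    pointCount (jumps p.1) (Set.Ico (q p.2.castSucc) (q p.2.succ)) ⁻¹' {c | c ≠ 0 ↔ p.1 = w p.2}

theorem disjoint_Ico_castSucc_succ {m : ℕ} {q : Fin (m + 1) → ℝ} (hq : Monotone q) :
    Pairwise (Function.onFun Disjoint fun i : Fin m => Set.Ico (q i.castSucc) (q i.succ)) := by
  have hlt : ∀ i j : Fin m, i < j → Disjoint (Set.Ico (q i.castSucc) (q i.succ))
      (Set.Ico (q j.castSucc) (q j.succ)) := fun i j hij => Set.disjoint_left.2 fun y hy hy' =>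
    ((hq (Fin.succ_le_castSucc_iff.2 hij)).trans hy'.1).not_gt hy.2
  intro i j hij
  rcases hij.lt_or_gt with h | h
  · exact hlt i j h
  · exact (hlt j i h).symm

/-- The clocks of `fillWord n n`, as a sequence. -/
def fillSeq (n : ℕ) (i : Fin (n * (n + 1) / 2)) : Fin (n + 1) :=
  (fillWord n n).get (i.cast (length_fillWord n n).symm)

theorem ofFn_fillSeq (n : ℕ) : List.ofFn (fillSeq n) = fillWord n n := by
  have : ∀ {m : ℕ} (l : List (Fin (n + 1))) (hm : m = l.length),
      List.ofFn (fun i : Fin m => l.get (i.cast hm)) = l := by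
    rintro _ l rfl
    exact List.ofFn_get l
  exact this _ _

theorem IsClockFamily.ringEvent_subset_syncEvent (h : IsClockFamily P lam jumps)
    {q : Fin (n * (n + 1) / 2 + 1) → ℝ} (hq : Monotone q) :
    ringEvent jumps (fillSeq n) q ⊆ syncEvent (flow jumps) (q (Fin.last _)) (q 0) := by
  intro ω hω x₁ x₂
  have hw : ∀ i k, (jumps k ω ∩ Set.Ico (q i.castSucc) (q i.succ)).Nonempty ↔ k = fillSeq n i :=
    fun i k => pointCount_ne_zero.symm.trans (Set.mem_iInter.1 hω (k, i))
  rw [flow_eq_foldl h.finite hq _ hw, flow_eq_foldl h.finite hq _ hw, ofFn_fillSeq,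
    foldl_hop_fillWord_eq, foldl_hop_fillWord_eq]

theorem disjoint_Ico_of_disjoint_partitions {m : ℕ} {q : ℕ → Fin (m + 1) → ℝ}
    (hq : ∀ j, Monotone (q j))
    (hdisj : Pairwise (Function.onFun Disjoint fun j => Set.Ico (q j 0) (q j (Fin.last m)))) :
    Pairwise (Function.onFun Disjoint fun p : ℕ × Fin m =>
      Set.Ico (q p.1 p.2.castSucc) (q p.1 p.2.succ)) := by
  rintro ⟨j, i⟩ ⟨j', i'⟩ hne
  by_cases hj : j = j'
  · subst hj
    exact disjoint_Ico_castSucc_succ (hq j) fun hi => hne (Prod.ext rfl hi)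
  · exact (hdisj hj).mono (Set.Ico_subset_Ico (hq j (Fin.zero_le _)) (hq j (Fin.le_last _)))
      (Set.Ico_subset_Ico (hq j' (Fin.zero_le _)) (hq j' (Fin.le_last _)))

/-- Ringing patterns along disjoint partitions are independent. -/
theorem IsClockFamily.measure_iInter_compl_ringEvent (h : IsClockFamily P lam jumps) {m : ℕ}
    (w : Fin m → Fin (n + 1)) {q : ℕ → Fin (m + 1) → ℝ} (hq : ∀ j, Monotone (q j))
    (hdisj : Pairwise (Function.onFun Disjoint fun j => Set.Ico (q j 0) (q j (Fin.last m))))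
    (N : ℕ) : P (⋂ j ∈ Finset.range N, (ringEvent jumps w (q j))ᶜ) =
      ∏ j ∈ Finset.range N, P (ringEvent jumps w (q j))ᶜ := by
  -- Group the independent counts by the number `p.2.1` of the partition; the `j`-th pattern depends
  -- on group `j` only.
  refine ((iIndepFun_iff_iIndep _ _ _).1 (h.iIndepFun_pointCount
    (disjoint_Ico_of_disjoint_partitions hq hdisj))).measure_iInter_range
      (fun p => (h.measurable_pointCount p.1 _ _).comap_le) (fun p => p.2.1)
      (fun j => MeasurableSet.compl (MeasurableSet.iInter fun p => ?_)) N
  refine le_iSup₂ (f := fun (p : Fin (n + 1) × ℕ × Fin m) (_ : p.2.1 = j) =>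
    MeasurableSpace.comap (pointCount (jumps p.1)
      (Set.Ico (q p.2.1 p.2.2.castSucc) (q p.2.1 p.2.2.succ))) inferInstance)
    (p.1, j, p.2) rfl _ ?_
  exact ⟨{c | c ≠ 0 ↔ p.1 = w p.2}, .of_discrete, rfl⟩

theorem IsClockFamily.measurableSet_ringEvent (h : IsClockFamily P lam jumps) {m : ℕ}
    (w : Fin m → Fin (n + 1)) (q : Fin (m + 1) → ℝ) : MeasurableSet (ringEvent jumps w q) :=
  .iInter fun p => h.measurable_pointCount p.1 _ _ .of_discrete

variable [IsProbabilityMeasure P]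

/-- The lower bound `r` serves a clock that must ring, the upper bound `R` one that must be silent;
the minimum covers both. -/
theorem IsClockFamily.le_measure_ring (h : IsClockFamily P lam jumps) {r R a b : ℝ} (hab : a ≤ b)
    {k : Fin (n + 1)} (hr : r ≤ ∫ s in a..b, lam k s) (hR : (∫ s in a..b, lam k s) ≤ R)
    (c : Prop) : ENNReal.ofReal (min (1 - Real.exp (-r)) (Real.exp (-R))) ≤
      P {ω | pointCount (jumps k) (Set.Ico a b) ω ≠ 0 ↔ c} := by
  have hzero := (h.poisson k).measure_pointCount_Ico_eq_zero (h.not_flat k) hab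
  have hpre : P (pointCount (jumps k) (Set.Ico a b) ⁻¹' {0}) =
      ENNReal.ofReal (Real.exp (-∫ s in a..b, lam k s)) := hzero
  by_cases hc : c
  · have hcompl : {ω | pointCount (jumps k) (Set.Ico a b) ω ≠ 0 ↔ c} =
        (pointCount (jumps k) (Set.Ico a b) ⁻¹' {0})ᶜ := by
      ext ω
      simp [hc]
    rw [hcompl, prob_compl_eq_one_sub (h.measurable_pointCount k a b (measurableSet_singleton 0)),
      hpre, ← ENNReal.ofReal_one, ← ENNReal.ofReal_sub _ (Real.exp_pos _).le]
    refine ENNReal.ofReal_le_ofReal ((min_le_left _ _).trans ?_)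
    gcongr
  · have hset : {ω | pointCount (jumps k) (Set.Ico a b) ω ≠ 0 ↔ c} =
        {ω | pointCount (jumps k) (Set.Ico a b) ω = 0} := by
      ext ω
      simp [hc]
    rw [hset, hzero]
    refine ENNReal.ofReal_le_ofReal ((min_le_right _ _).trans ?_)
    gcongr

theorem IsClockFamily.le_measure_ringEvent (h : IsClockFamily P lam jumps) {r R : ℝ} {m : ℕ}
    (w : Fin m → Fin (n + 1)) {q : Fin (m + 1) → ℝ} (hq : Monotone q)
    (hb : ∀ (i : Fin m) (k : Fin (n + 1)), r ≤ (∫ t in (q i.castSucc)..(q i.succ), lam k t) ∧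
      (∫ t in (q i.castSucc)..(q i.succ), lam k t) ≤ R) :
    ENNReal.ofReal (min (1 - Real.exp (-r)) (Real.exp (-R))) ^ ((n + 1) * m) ≤
      P (ringEvent jumps w q) := by
  rw [ringEvent, (h.iIndepFun_pointCount (disjoint_Ico_castSucc_succ hq)).meas_iInter
    fun p => ⟨{c | c ≠ 0 ↔ p.1 = w p.2}, .of_discrete, rfl⟩]
  calc _ = ∏ _p : Fin (n + 1) × Fin m,
        ENNReal.ofReal (min (1 - Real.exp (-r)) (Real.exp (-R))) := by simp
    _ ≤ _ := Finset.prod_le_prod' fun p _ =>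
        h.le_measure_ring (hq (Fin.castSucc_le_succ _)) (hb p.2 p.1).1 (hb p.2 p.1).2 _

/-- Jointly bounded rates along infinitely many disjoint time intervals synchronize all solutions,
with geometrically decaying failure probabilities. -/
theorem IsClockFamily.exists_measure_iInter_compl_syncEvent_le (h : IsClockFamily P lam jumps)
    {r : ℝ} (R : ℝ) (hr : 0 < r) : ∃ ρ : ℝ, 0 < ρ ∧ ρ < 1 ∧ ∀ τ τ' : ℕ → ℝ,
      (∀ j, JointlyBounded lam r R (n * (n + 1) / 2) (τ j) (τ' j)) →
      Pairwise (Function.onFun Disjoint fun j => Set.Ico (τ j) (τ' j)) → ∀ N : ℕ,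
      P (⋂ j ∈ Finset.range N, (syncEvent (flow jumps) (τ' j) (τ j))ᶜ) ≤
        ENNReal.ofReal ρ ^ N := by
  set c := min (1 - Real.exp (-r)) (Real.exp (-R))
  have hc : 0 < c := lt_min (by simpa using hr) (Real.exp_pos _)
  have hc1 : c ≤ 1 := (min_le_left _ _).trans (by linarith [Real.exp_pos (-r)])
  set p := c ^ ((n + 1) * (n * (n + 1) / 2))
  have hp : 0 < p := pow_pos hc _
  have hp1 : p ≤ 1 := pow_le_one₀ hc.le hc1
  -- Halving `p` keeps the ratio strictly positive even if `p = 1`; the exponential rate needs its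
  -- logarithm and its inverse.
  refine ⟨1 - p / 2, by linarith, by linarith, fun τ τ' hb hdisj N => ?_⟩
  choose q hq h0 hlast hb using hb
  have hmono := fun j => (hq j).monotone
  calc P (⋂ j ∈ Finset.range N, (syncEvent (flow jumps) (τ' j) (τ j))ᶜ)
      ≤ P (⋂ j ∈ Finset.range N, (ringEvent jumps (fillSeq n) (q j))ᶜ) := by
        refine measure_mono (Set.iInter₂_mono fun j _ => Set.compl_subset_compl.2 ?_)
        rw [← h0, ← hlast]
        exact h.ringEvent_subset_syncEvent (hmono j)
    _ = ∏ j ∈ Finset.range N, P (ringEvent jumps (fillSeq n) (q j))ᶜ :=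
        h.measure_iInter_compl_ringEvent _ hmono (by simpa only [h0, hlast] using hdisj) N
    _ ≤ ∏ _j ∈ Finset.range N, ENNReal.ofReal (1 - p / 2) := by
        refine Finset.prod_le_prod' fun j _ => ?_
        rw [prob_compl_eq_one_sub (h.measurableSet_ringEvent _ _)]
        calc 1 - P (ringEvent jumps (fillSeq n) (q j)) ≤ 1 - ENNReal.ofReal p := by
              refine tsub_le_tsub_left ?_ _
              rw [ENNReal.ofReal_pow hc.le]
              exact h.le_measure_ringEvent _ (hmono j) (hb j)
          _ = ENNReal.ofReal (1 - p) := by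
              rw [← ENNReal.ofReal_one, ← ENNReal.ofReal_sub _ hp.le]
          _ ≤ _ := ENNReal.ofReal_le_ofReal (by linarith)
    _ = _ := by simp

theorem IsClockFamily.ae_exists_mem_syncEvent (h : IsClockFamily P lam jumps) {r R : ℝ}
    (hr : 0 < r) {τ τ' : ℕ → ℝ}
    (hb : ∀ j, JointlyBounded lam r R (n * (n + 1) / 2) (τ j) (τ' j))
    (hdisj : Pairwise (Function.onFun Disjoint fun j => Set.Ico (τ j) (τ' j))) :
    ∀ᵐ ω ∂P, ∃ j, ω ∈ syncEvent (flow jumps) (τ' j) (τ j) := by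
  obtain ⟨ρ, h0, h1, hρ⟩ := h.exists_measure_iInter_compl_syncEvent_le R hr
  have hlim : Tendsto (fun N => ENNReal.ofReal ρ ^ N) atTop (𝓝 0) :=
    ENNReal.tendsto_pow_atTop_nhds_zero_of_lt_one (by simpa using h1)
  refine le_antisymm (ge_of_tendsto' hlim fun N => (measure_mono ?_).trans (hρ τ τ' hb hdisj N))
    zero_le
  intro ω hω
  exact Set.mem_iInter₂.2 fun j _ hj => hω ⟨j, hj⟩

/-- Iterating the choice of `t₀` backwards from an integer `z` gives infinitely many disjoint
windows, one of which synchronizes almost surely. Countably many `z` need a single null set, and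
synchronization by time `⌊t⌋` persists to `t`. -/
theorem IsClockFamily.ae_attractorSet_eq_singleton (h : IsClockFamily P lam jumps) {r R : ℝ}
    (hr : 0 < r) (hb : ∀ t, ∃ t₀ < t, JointlyBounded lam r R (n * (n + 1) / 2) t₀ t) :
    ∀ᵐ ω ∂P, ∀ t, ∃ x, attractorSet (flow jumps) t ω = {x} := by
  choose g hg hb using hb
  have hsync : ∀ z : ℤ, ∀ᵐ ω ∂P, ∃ t₀ ≤ (z : ℝ), ω ∈ syncEvent (flow jumps) z t₀ := by
    intro z
    set τ : ℕ → ℝ := fun j => g^[j] z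
    have hτ : ∀ j, τ (j + 1) = g (τ j) := fun j => Function.iterate_succ_apply' g j z
    have hanti : Antitone τ := antitone_nat_of_succ_le fun j => (hτ j).trans_le (hg _).le
    filter_upwards [h.ae_exists_mem_syncEvent hr (τ := fun j => τ (j + 1)) (τ' := τ)
      (fun j => by rw [hτ]; exact hb _) hanti.pairwise_disjoint_on_Ico_succ] with ω ⟨j, hj⟩
    exact ⟨τ (j + 1), hanti (Nat.zero_le _),
      h.isNRDS_flow.syncEvent_subset le_rfl (hanti (Nat.le_succ j)) (hanti (Nat.zero_le j)) hj⟩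
  filter_upwards [ae_all_iff.2 hsync] with ω hω t
  obtain ⟨t₀, ht₀, hmem⟩ := hω ⌊t⌋
  have : Nonempty (Config n) := ⟨fun _ => true⟩
  exact ⟨_, (h.isNRDS_flow.attractorSet_eq_of_mem_syncEvent (ht₀.trans (Int.floor_le t))
    (h.isNRDS_flow.syncEvent_subset le_rfl ht₀ (Int.floor_le t) hmem) fun _ => true).1⟩

/-! ### Synchronization under uniform bounds. -/

section UniformlyBounded

variable {r R Δ : ℝ}

theorem monotone_add_mul (hΔ : 0 < Δ) (t₀ : ℝ) : Monotone fun j : ℕ => t₀ + j * Δ :=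
  fun i j hij => by
    have : (i : ℝ) ≤ j := by exact_mod_cast hij
    simp only
    gcongr

theorem jointlyBounded_add_mul
    (hb : ∀ τ, JointlyBounded lam r R (n * (n + 1) / 2) τ (τ + Δ)) (t₀ : ℝ) (j : ℕ) :
    JointlyBounded lam r R (n * (n + 1) / 2) (t₀ + j * Δ) (t₀ + (j + 1 : ℕ) * Δ) := by
  convert hb (t₀ + j * Δ) using 1
  push_cast
  ring

theorem IsClockFamily.ae_exists_ge_mem_syncEvent (h : IsClockFamily P lam jumps) (hr : 0 < r)
    (hΔ : 0 < Δ) (hb : ∀ τ, JointlyBounded lam r R (n * (n + 1) / 2) τ (τ + Δ)) (t₀ : ℝ) :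
    ∀ᵐ ω ∂P, ∃ t, t₀ ≤ t ∧ ω ∈ syncEvent (flow jumps) t t₀ := by
  have hmono := monotone_add_mul hΔ t₀
  filter_upwards [h.ae_exists_mem_syncEvent hr (jointlyBounded_add_mul hb t₀)
    hmono.pairwise_disjoint_on_Ico_succ] with ω ⟨j, hj⟩
  have h0 : ∀ i : ℕ, t₀ ≤ t₀ + i * Δ := fun i => by simpa using hmono (Nat.zero_le i)
  exact ⟨_, h0 (j + 1), h.isNRDS_flow.syncEvent_subset (h0 j) (hmono (Nat.le_succ j)) le_rfl hj⟩

theorem IsClockFamily.exists_one_sub_syncEvent_le (h : IsClockFamily P lam jumps) (hr : 0 < r)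
    (hΔ : 0 < Δ) (hb : ∀ τ, JointlyBounded lam r R (n * (n + 1) / 2) τ (τ + Δ)) :
    ∃ C γ : ℝ, 0 < C ∧ 0 < γ ∧ ∀ t t₀ : ℝ, t₀ ≤ t →
      1 - P.real (syncEvent (flow jumps) t t₀) ≤ C * Real.exp (-γ * (t - t₀)) := by
  obtain ⟨ρ, h0, h1, hρ⟩ := h.exists_measure_iInter_compl_syncEvent_le R hr
  -- `⌊(t - t₀) / Δ⌋` full windows fit into the interval; the factor `ρ⁻¹` pays for the rounding.
  refine ⟨ρ⁻¹, -Real.log ρ / Δ, inv_pos.2 h0, div_pos (neg_pos.2 (Real.log_neg h0 h1)) hΔ,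
    fun t t₀ ht => ?_⟩
  have hmono := monotone_add_mul hΔ t₀
  have hge : ∀ i : ℕ, t₀ ≤ t₀ + i * Δ := fun i => by simpa using hmono (Nat.zero_le i)
  set N := ⌊(t - t₀) / Δ⌋₊
  have hN : (N : ℝ) * Δ ≤ t - t₀ :=
    (le_div_iff₀ hΔ).1 (Nat.floor_le (div_nonneg (sub_nonneg.2 ht) hΔ.le))
  have hcompl : P (syncEvent (flow jumps) t t₀)ᶜ ≤ ENNReal.ofReal ρ ^ N := by
    refine (measure_mono ?_).trans (hρ _ _ (jointlyBounded_add_mul hb t₀)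
      hmono.pairwise_disjoint_on_Ico_succ N)
    refine Set.subset_iInter₂ fun j hj => Set.compl_subset_compl.2 ?_
    refine h.isNRDS_flow.syncEvent_subset (hge j) (hmono (Nat.le_succ j)) ?_
    have := hmono (Nat.succ_le_of_lt (Finset.mem_range.1 hj))
    simp only [Nat.succ_eq_add_one] at this
    linarith
  have hcompl' : P.real (syncEvent (flow jumps) t t₀)ᶜ ≤ ρ ^ N := by
    rw [← ENNReal.ofReal_pow h0.le] at hcompl
    exact ENNReal.toReal_le_of_le_ofReal (by positivity) hcompl
  -- Subadditivity suffices here, so measurability of the synchronization event is not needed.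
  have hone : 1 ≤ P.real (syncEvent (flow jumps) t t₀) + P.real (syncEvent (flow jumps) t t₀)ᶜ := by
    simpa using measureReal_union_le (μ := P) (syncEvent (flow jumps) t t₀)
      (syncEvent (flow jumps) t t₀)ᶜ
  calc 1 - P.real (syncEvent (flow jumps) t t₀) ≤ ρ ^ N := by linarith
    _ = ρ⁻¹ * ρ ^ (N + 1) := by
        rw [pow_succ]
        field_simp
    _ = ρ⁻¹ * Real.exp (Real.log ρ * (N + 1 : ℕ)) := by
        rw [mul_comm (Real.log ρ), Real.exp_nat_mul, Real.exp_log h0]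
    _ ≤ ρ⁻¹ * Real.exp (-(-Real.log ρ / Δ) * (t - t₀)) := by
        rw [show -(-Real.log ρ / Δ) * (t - t₀) = Real.log ρ * ((t - t₀) / Δ) by ring]
        have hlt := (Nat.lt_floor_add_one ((t - t₀) / Δ)).le
        have := mul_le_mul_of_nonpos_left hlt (Real.log_neg h0 h1).le
        refine mul_le_mul_of_nonneg_left (Real.exp_le_exp.2 ?_) (inv_pos.2 h0).le
        exact_mod_cast this

end UniformlyBounded

end TASEP

theorem mainTheorem3 {n : ℕ} (hn : 1 ≤ n) {Ω : Type*} [MeasurableSpace Ω] (P : Measure Ω)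
    [IsProbabilityMeasure P] (lam : Fin (n + 1) → ℝ → ℝ) (jumps : Fin (n + 1) → Ω → Set ℝ)
    (hjumps : TASEP.IsClockFamily P lam jumps) :
    IsNRDS (TASEP.flow jumps) ∧
    ((∃ r R : ℝ, 0 < r ∧ r < R ∧ ∀ t : ℝ, ∃ t₀ < t,
        TASEP.JointlyBounded lam r R (n * (n + 1) / 2) t₀ t) →
      IsPullbackAttractor P (TASEP.flow jumps) (attractorSet (TASEP.flow jumps)) ∧
      ∀ᵐ ω ∂P, ∀ t : ℝ, ∃ x, attractorSet (TASEP.flow jumps) t ω = {x}) ∧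
    ((∃ r R Δ : ℝ, 0 < r ∧ r < R ∧ 0 < Δ ∧ ∀ τ : ℝ,
        TASEP.JointlyBounded lam r R (n * (n + 1) / 2) τ (τ + Δ)) →
      IsForwardAttractor P (TASEP.flow jumps) (attractorSet (TASEP.flow jumps)) ∧
      ∃ C γ : ℝ, 0 < C ∧ 0 < γ ∧ ∀ t t₀ : ℝ, t₀ ≤ t →
        1 - P.real (syncEvent (TASEP.flow jumps) t t₀) ≤ C * Real.exp (-γ * (t - t₀))) := by
  have : Nonempty (TASEP.Config n) := ⟨fun _ => true⟩
  have hφ := hjumps.isNRDS_flow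
  refine ⟨hφ, ?_, ?_⟩
  · rintro ⟨r, R, hr, -, hb⟩
    exact ⟨hφ.isPullbackAttractor_attractorSet P, hjumps.ae_attractorSet_eq_singleton hr hb⟩
  · rintro ⟨r, R, Δ, hr, -, hΔ, hb⟩
    exact ⟨hφ.isForwardAttractor_attractorSet P (hjumps.ae_exists_ge_mem_syncEvent hr hΔ hb),
      hjumps.exists_one_sub_syncEvent_le hr hΔ hb⟩
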